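/- For a symmetric matrix $A\in\mathbb{R}^{d\times d}$ with eigendecomposition $A=\sum_i\lambda_iu_iu_i^\top$ put $f(A)=\sum_i f(\lambda_i)u_iu_i^\top$ and $I=[\lambda_{\min}(A),\lambda_{\max}(A)]$, and for a function $g$ put $\|g\|_I=\sup_{x\in I}|g(x)|$. For a unit vector $b$, let $T_k(b)$ be the symmetric tridiagonal matrix with diagonal $\alpha_0,\alpha_1,\dots$ and off-diagonal $\beta_0,\beta_1,\dots$ produced by the (exact arithmetic) Lanczos algorithm started from $q_0=b$, $q_{-1}=0$, $\beta_{-1}=0$: for $n=0,\dots,k-1$, $$y_{n+1}=Aq_n-\beta_{n-1}q_{n-1},\quad \alpha_n=q_n^\top y_{n+1},\quad z_{n+1}=y_{n+1}-\alpha_nq_n,\quad \beta_n=\|z_{n+1}\|,\quad q_{n+1}=z_{n+1}/\beta_n,$$ stopping early after computing the first $\beta_n=0$; so $T_k(b)$ has as many rows as iterations were carried out. Let $\mathrm{lanQF}_k(f;A,b)=e_1^\top f(T_k(b))e_1$, and for unit vectors $b_1,\dots,b_m$ let $$\mathrm{SLQ}_{k,m}(f)=\frac1m\sum_{\ell=1}^m\mathrm{lanQF}_k(f;A,b_\ell).$$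 **Theorem.** There is a universal constant $C>0$ such that for all integers $d,k,m\ge1$, every symmetric $A\in\mathbb{R}^{d\times d}$, every $f:\mathbb{R}\to\mathbb{R}$ bounded on $I$, and every $\delta\in(0,1)$: if $b_1,\dots,b_m$ are independent and uniformly distributed on the unit sphere of $\mathbb{R}^d$, then $$\mathbb{P}\left[\left|d^{-1}\operatorname{tr}(f(A))-\mathrm{SLQ}_{k,m}(f)\right|>\|f\|_I\sqrt{\frac{\log(2/\delta)}{Cdm}}+2\min_{\deg p<2k}\|f-p\|_I\right]\le\delta ,$$ where $p$ ranges over real polynomials (the probability is an outer probability if the event is not measurable). Moreover, for every outcome, the error splits into trace-estimator noise and Lanczos-quadrature error: $$\left|\tfrac1d\operatorname{tr}(f(A))-\mathrm{SLQ}_{k,m}(f)\right|\le\left|\tfrac1d\operatorname{tr}(f(A))-\tfrac1m\sum_{\ell=1}^mb_\ell^\top f(A)b_\ell\right|+\tfrac1m\sum_{\ell=1}^m\left|b_\ell^\top f(A)b_\ell-\mathrm{lanQF}_k(f;A,b_\ell)\right|.$$ -/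

import Mathlib

open MeasureTheory ProbabilityTheory Matrix Polynomial

noncomputable section

/-- The max-norm of `f` over a set `S`. -/
def supNormOn (S : Set ℝ) (f : ℝ → ℝ) : ℝ :=
  sSup ((fun x => |f x|) '' S)

/-- The interval from the smallest to the largest eigenvalue of a symmetric matrix `A`. -/
def spectralInterval {d : ℕ} (A : Matrix (Fin d) (Fin d) ℝ) : Set ℝ :=
  Set.Icc (sInf (spectrum ℝ A)) (sSup (spectrum ℝ A))

/-- The error, in max-norm over `S`, of the best approximation of `f` by real polynomials
of degree less than `n`. -/
def bestPolyError (S : Set ℝ) (n : ℕ) (f : ℝ → ℝ) : ℝ :=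
  ⨅ p : {p : ℝ[X] // p.degree < (n : WithBot ℕ)}, supNormOn S (fun x => f x - p.1.eval x)

/-- The uniform probability distribution on the unit sphere of `ℝ ^ d`, as a measure on `ℝ ^ d`:
the normalized surface measure. -/
def sphereUniform (d : ℕ) : Measure (EuclideanSpace ℝ (Fin d)) :=
  let σ : Measure (Metric.sphere (0 : EuclideanSpace ℝ (Fin d)) 1) :=
    (volume : Measure (EuclideanSpace ℝ (Fin d))).toSphere
  ((σ Set.univ)⁻¹ • σ).map Subtype.val

section Lanczos

variable {d : ℕ} (A : Matrix (Fin d) (Fin d) ℝ) (b : EuclideanSpace ℝ (Fin d))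

/-- The state `(β_{n-1}, q_{n-1}, q_n)` of the Lanczos algorithm on `(A, b)` before iteration `n`;
initially `β_{-1} = 0`, `q_{-1} = 0`, `q_0 = b / ‖b‖`. Once some `β_n` vanishes the algorithm has
terminated, and later states are not used. -/
def lanczosState :
    ℕ → ℝ × EuclideanSpace ℝ (Fin d) × EuclideanSpace ℝ (Fin d)
  | 0 => (0, 0, ‖b‖⁻¹ • b)
  | n + 1 =>
    let β' := (lanczosState n).1
    let q' := (lanczosState n).2.1
    let q := (lanczosState n).2.2
    let y := Matrix.toEuclideanLin A q - β' • q'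
    let α := inner ℝ q y
    let z := y - α • q
    (‖z‖, q, ‖z‖⁻¹ • z)

/-- The Lanczos vector `q_n`. -/
def lanczosVec (n : ℕ) : EuclideanSpace ℝ (Fin d) := (lanczosState A b n).2.2

/-- The off-diagonal Lanczos coefficient `β_n`. -/
def lanczosBeta (n : ℕ) : ℝ := (lanczosState A b (n + 1)).1

/-- The diagonal Lanczos coefficient `α_n = q_nᵀ (A q_n - β_{n-1} q_{n-1})`. -/
def lanczosAlpha (n : ℕ) : ℝ :=
  inner ℝ (lanczosVec A b n)
    (Matrix.toEuclideanLin A (lanczosVec A b n)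
      - (lanczosState A b n).1 • (lanczosState A b n).2.1)

/-- The number of iterations carried out when Lanczos is run for at most `k` iterations:
iteration `n < k` is carried out unless the algorithm stopped because of some `β_j = 0`, `j < n`.
-/
def lanczosSteps (k : ℕ) : ℕ :=
  Nat.card {n : ℕ // n < k ∧ ∀ j < n, lanczosBeta A b j ≠ 0}

/-- The `r × r` symmetric tridiagonal matrix with diagonal `α_0, …, α_{r-1}` and off-diagonal
`β_0, …, β_{r-2}`. -/
def lanczosTridiag (r : ℕ) : Matrix (Fin r) (Fin r) ℝ :=
  Matrix.of fun i j =>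
    if i = j then lanczosAlpha A b i
    else if (i : ℕ) + 1 = j then lanczosBeta A b i
    else if (j : ℕ) + 1 = i then lanczosBeta A b j
    else 0

/-- The top left entry `e₁ᵀ f(T) e₁` of `f(T)`, for `T` of size `r × r`. For a symmetric matrix `T`,
`cfc f T` is `∑ f(θ_i) v_i v_iᵀ`, where `v_i` is an orthonormal eigenbasis with eigenvalues `θ_i`.
-/
def firstEntry (f : ℝ → ℝ) {r : ℕ} (T : Matrix (Fin r) (Fin r) ℝ) : ℝ :=
  let e₁ : Fin r → ℝ := fun i => if (i : ℕ) = 0 then 1 else 0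
  e₁ ⬝ᵥ (cfc f T *ᵥ e₁)

/-- The `k`-th Lanczos quadratic form approximation `‖b‖² e₁ᵀ f(T_k) e₁` to `bᵀ f(A) b`, where
`T_k` is the tridiagonal matrix output by Lanczos on `(A, b)` run for `k` iterations (or until it
terminates). -/
def lanQF (k : ℕ) (f : ℝ → ℝ) : ℝ :=
  ‖b‖ ^ 2 * firstEntry f (lanczosTridiag A b (lanczosSteps A b k))

end Lanczos

/-- The stochastic Lanczos quadrature approximation to `d⁻¹ tr f(A)` built from the test vectors
`b_1, …, b_m`. -/
def slq {d m : ℕ} (k : ℕ) (f : ℝ → ℝ) (A : Matrix (Fin d) (Fin d) ℝ)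
    (b : Fin m → EuclideanSpace ℝ (Fin d)) : ℝ :=
  (m : ℝ)⁻¹ * ∑ l, lanQF A (b l) k f

/-- The quadratic form `bᵀ M b`. -/
def quadForm {d : ℕ} (M : Matrix (Fin d) (Fin d) ℝ) (b : EuclideanSpace ℝ (Fin d)) : ℝ :=
  b.ofLp ⬝ᵥ (M *ᵥ b.ofLp)

end

/-! ### The uniform distribution on the sphere -/

/-! The triangle inequality separates the noise of the quadratic trace estimator from the quadrature
error, and the two are bounded independently.

Noise: after rotating the sphere to an eigenbasis of `A`, the form is S(x) = ∑ μ_k x_k² with μ_k =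
f(λ_k). Differentiating the invariance of ∫ x_i x_j e^{tS} under rotation of the (i, j)-plane,
weighting by μ_j - μ_i and summing over all pairs gives a Stein identity
(`integral_centered_mul_exp`). It bounds the derivative of the centred moment generating function φ
by φ' ≤ (2F²/d) t φ for t ≥ 0, where |μ_k| ≤ F. Grönwall then gives a sub-Gaussian form with
variance proxy 2F²/d, which carries the factor 1/d. Independence and a two-sided Chernoff bound
finish, with C = 1/4.

Quadrature: with Q the matrix of Lanczos vectors, QᵀQ = 1, QᵀAQ = T and Aⁿb = QTⁿe₁ for n < k.
Splitting a power of `A` symmetrically shows that bᵀp(A)b = e₁ᵀp(T)e₁ whenever deg p < 2k.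
Eigenvalues of T are Rayleigh quotients of `A`, so they stay in I; replacing f by p costs at most ‖f
- p‖_I on each side, whence the factor 2. -/

open scoped Pointwise in
lemma sphereUniform_apply {d : ℕ} {s : Set (EuclideanSpace ℝ (Fin d))} (hs : MeasurableSet s) :
    sphereUniform d s =
      ((volume : Measure (EuclideanSpace ℝ (Fin d))).toSphere Set.univ)⁻¹ *
        (Module.finrank ℝ (EuclideanSpace ℝ (Fin d)) *
          volume ((Set.Ioo (0 : ℝ) 1) • (s ∩ Metric.sphere 0 1))) := by
  rw [sphereUniform, Measure.map_apply measurable_subtype_coe hs, Measure.smul_apply,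
    Measure.toSphere_apply' _ (measurable_subtype_coe hs), Subtype.image_preimage_coe, smul_eq_mul,
    Set.inter_comm]

lemma isProbabilityMeasure_sphereUniform {d : ℕ} (hd : 0 < d) :
    IsProbabilityMeasure (sphereUniform d) := by
  have : NeZero d := ⟨hd.ne'⟩
  have : Nontrivial (EuclideanSpace ℝ (Fin d)) := by
    refine ⟨0, EuclideanSpace.single ⟨0, hd⟩ 1, fun h => ?_⟩
    simpa using congrArg (fun x : EuclideanSpace ℝ (Fin d) => x ⟨0, hd⟩) h
  constructor
  rw [sphereUniform, Measure.map_apply measurable_subtype_coe .univ, Set.preimage_univ,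
    Measure.smul_apply, smul_eq_mul]
  refine ENNReal.inv_mul_cancel ?_ (measure_ne_top _ _)
  rw [Ne, Measure.measure_univ_eq_zero]
  exact Measure.toSphere_ne_zero _

-- Surface measure is defined through the volume of cones; an isometry carries cones to cones and
-- preserves volume.
open scoped Pointwise in
lemma sphereUniform_map_linearIsometryEquiv {d : ℕ}
    (U : EuclideanSpace ℝ (Fin d) ≃ₗᵢ[ℝ] EuclideanSpace ℝ (Fin d)) :
    (sphereUniform d).map U = sphereUniform d := by
  ext s hs
  have hU : Measurable U := U.continuous.measurable
  rw [Measure.map_apply hU hs, sphereUniform_apply hs, sphereUniform_apply (hU hs)]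
  have h : (Set.Ioo (0 : ℝ) 1) • (U ⁻¹' s ∩ Metric.sphere 0 1) =
      U.toMeasurableEquiv ⁻¹' ((Set.Ioo (0 : ℝ) 1) • (s ∩ Metric.sphere 0 1)) := by
    ext x
    simp only [Set.mem_smul, Set.mem_inter_iff, Set.mem_preimage, mem_sphere_zero_iff_norm]
    constructor
    · rintro ⟨r, hr, y, ⟨hy, hn⟩, rfl⟩
      exact ⟨r, hr, U y, ⟨hy, by simpa using hn⟩, by simp⟩
    · rintro ⟨r, hr, y, ⟨hy, hn⟩, hx⟩
      refine ⟨r, hr, U.symm y, ⟨by simpa using hy, by simpa using hn⟩, ?_⟩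
      apply U.injective
      simpa using hx
  rw [h, MeasurePreserving.measure_preimage_equiv]
  exact U.measurePreserving

lemma ae_norm_eq_one_sphereUniform (d : ℕ) : ∀ᵐ x ∂(sphereUniform d), ‖x‖ = 1 := by
  have hs : MeasurableSet {x : EuclideanSpace ℝ (Fin d) | ‖x‖ = 1} :=
    measurableSet_eq_fun measurable_norm measurable_const
  rw [ae_iff]
  change sphereUniform d {x | ‖x‖ = 1}ᶜ = 0
  rw [sphereUniform, Measure.map_apply measurable_subtype_coe hs.compl]
  convert measure_empty (μ := _)
  · ext x
    simp
  · infer_instance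

/-- The rotation by the angle `θ` in the plane of the coordinates `i ≠ j`. -/
noncomputable def planeRotationLinear {d : ℕ} (i j : Fin d) (θ : ℝ) :
    EuclideanSpace ℝ (Fin d) →ₗ[ℝ] EuclideanSpace ℝ (Fin d) where
  toFun x := x + ((Real.cos θ - 1) * x i - Real.sin θ * x j) • EuclideanSpace.single i 1
    + (Real.sin θ * x i + (Real.cos θ - 1) * x j) • EuclideanSpace.single j 1
  map_add' x y := by ext k; simp; split_ifs <;> ring
  map_smul' r x := by ext k; simp; split_ifs <;> ring

lemma norm_planeRotationLinear {d : ℕ} {i j : Fin d} (hij : i ≠ j) (θ : ℝ)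
    (x : EuclideanSpace ℝ (Fin d)) : ‖planeRotationLinear i j θ x‖ = ‖x‖ := by
  have h : ∀ a b : ℝ, ‖x + a • EuclideanSpace.single i (1 : ℝ)
      + b • EuclideanSpace.single j (1 : ℝ)‖ ^ 2
      = ‖x‖ ^ 2 + 2 * a * x i + 2 * b * x j + a ^ 2 + b ^ 2 := by
    intro a b
    rw [← real_inner_self_eq_norm_sq, ← real_inner_self_eq_norm_sq]
    simp only [inner_add_left, inner_add_right, inner_smul_left, inner_smul_right,
      EuclideanSpace.inner_single_left, EuclideanSpace.inner_single_right]
    simp [hij, hij.symm]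
    ring
  refine (sq_eq_sq₀ (norm_nonneg _) (norm_nonneg _)).1 ?_
  change ‖x + _ • _ + _ • _‖ ^ 2 = _
  rw [h]
  linear_combination (x i ^ 2 + x j ^ 2) * Real.sin_sq_add_cos_sq θ

/-- The rotation by the angle `θ` in the plane of the coordinates `i ≠ j`, as an isometry. -/
noncomputable def planeRotation {d : ℕ} {i j : Fin d} (hij : i ≠ j) (θ : ℝ) :
    EuclideanSpace ℝ (Fin d) ≃ₗᵢ[ℝ] EuclideanSpace ℝ (Fin d) :=
  LinearIsometry.toLinearIsometryEquiv
    ⟨planeRotationLinear i j θ, norm_planeRotationLinear hij θ⟩ rfl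

lemma planeRotation_apply {d : ℕ} {i j : Fin d} (hij : i ≠ j) (θ : ℝ)
    (x : EuclideanSpace ℝ (Fin d)) (k : Fin d) :
    planeRotation hij θ x k =
      if k = i then Real.cos θ * x i - Real.sin θ * x j
      else if k = j then Real.sin θ * x i + Real.cos θ * x j else x k := by
  change (x + ((Real.cos θ - 1) * x i - Real.sin θ * x j) • EuclideanSpace.single i (1 : ℝ)
    + (Real.sin θ * x i + (Real.cos θ - 1) * x j) • EuclideanSpace.single j (1 : ℝ)) k = _
  rcases eq_or_ne k i with rfl | hi
  · simp [hij]; ring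
  · rcases eq_or_ne k j with rfl | hj
    · simp [hi]; ring
    · simp [hi, hj]

/-! ### Concentration of quadratic forms on the sphere -/

lemma abs_coord_le {d : ℕ} {x : EuclideanSpace ℝ (Fin d)} (hx : ‖x‖ = 1) (i : Fin d) :
    |x i| ≤ 1 := by
  simpa [hx] using PiLp.norm_apply_le x i

/-- The measure lives on the compact sphere, so continuous functions are a.e. bounded, however fast
they grow elsewhere. -/
lemma integrable_sphereUniform_of_continuous {d : ℕ} (hd : 0 < d)
    {g : EuclideanSpace ℝ (Fin d) → ℝ} (hg : Continuous g) : Integrable g (sphereUniform d) := by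
  have := isProbabilityMeasure_sphereUniform hd
  obtain ⟨C, hC⟩ := (isCompact_sphere (0 : EuclideanSpace ℝ (Fin d)) 1).exists_bound_of_continuousOn
    hg.continuousOn
  refine Integrable.of_bound hg.aestronglyMeasurable C ?_
  filter_upwards [ae_norm_eq_one_sphereUniform d] with x hx
  exact hC x (by simpa using hx)

/-- Invariance under the rotations of a coordinate plane, differentiated at the identity. -/
lemma integral_rotation_generator_eq_zero {d : ℕ} (hd : 0 < d) {i j : Fin d} (hij : i ≠ j)
    (μ : Fin d → ℝ) (t : ℝ) :
    ∫ x, (x i ^ 2 - x j ^ 2 + 2 * t * (μ j - μ i) * (x i ^ 2 * x j ^ 2)) *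
      Real.exp (t * ∑ k, μ k * x k ^ 2) ∂(sphereUniform d) = 0 := by
  have := isProbabilityMeasure_sphereUniform hd
  set S : EuclideanSpace ℝ (Fin d) → ℝ := fun x => ∑ k, μ k * x k ^ 2 with hS
  set p : ℝ → EuclideanSpace ℝ (Fin d) → ℝ :=
    fun θ x => Real.cos θ * x i - Real.sin θ * x j with hp
  set q : ℝ → EuclideanSpace ℝ (Fin d) → ℝ :=
    fun θ x => Real.sin θ * x i + Real.cos θ * x j with hq
  have hrot : ∀ θ x, S (planeRotation hij θ x) = S x + (μ j - μ i) * (q θ x ^ 2 - x j ^ 2) := by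
    intro θ x
    have h : ∀ y : EuclideanSpace ℝ (Fin d), S y = μ i * y i ^ 2 + (μ j * y j ^ 2 +
        ∑ k ∈ (Finset.univ.erase i).erase j, μ k * y k ^ 2) := by
      intro y
      rw [Finset.add_sum_erase _ (fun k => μ k * y k ^ 2) (by simp [hij.symm]),
        Finset.add_sum_erase _ (fun k => μ k * y k ^ 2) (by simp)]
    rw [h, h]
    have h' : ∑ k ∈ (Finset.univ.erase i).erase j, μ k * planeRotation hij θ x k ^ 2
        = ∑ k ∈ (Finset.univ.erase i).erase j, μ k * x k ^ 2 := by
      refine Finset.sum_congr rfl fun k hk => ?_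
      simp only [Finset.mem_erase] at hk
      rw [planeRotation_apply, if_neg hk.2.1, if_neg hk.1]
    rw [h', planeRotation_apply, planeRotation_apply, if_pos rfl, if_neg hij.symm, if_pos rfl]
    simp only [hq]
    linear_combination μ i * (x i ^ 2 + x j ^ 2) * Real.sin_sq_add_cos_sq θ
  -- `F θ` is x_i x_j e^{tS} composed with the rotation by θ. Its integral does not depend on θ, and
  -- `F'` is its θ-derivative.
  set F : ℝ → EuclideanSpace ℝ (Fin d) → ℝ := fun θ x =>
    p θ x * q θ x * Real.exp (t * (S x + (μ j - μ i) * (q θ x ^ 2 - x j ^ 2))) with hF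
  set F' : ℝ → EuclideanSpace ℝ (Fin d) → ℝ := fun θ x =>
    (p θ x ^ 2 - q θ x ^ 2 + 2 * t * (μ j - μ i) * (p θ x ^ 2 * q θ x ^ 2)) *
      Real.exp (t * (S x + (μ j - μ i) * (q θ x ^ 2 - x j ^ 2))) with hF'
  have hFc : ∀ θ, Continuous (F θ) := fun θ => by simp only [hF, hp, hq, hS]; fun_prop
  have hFc' : ∀ θ, Continuous (F' θ) := fun θ => by simp only [hF', hp, hq, hS]; fun_prop
  have hder : ∀ x θ, HasDerivAt (F · x) (F' θ x) θ := by
    intro x θ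
    have hp' : HasDerivAt (fun θ => p θ x) (-q θ x) θ := by
      have := ((Real.hasDerivAt_cos θ).mul_const (x i)).sub
        ((Real.hasDerivAt_sin θ).mul_const (x j))
      exact this.congr_deriv (by simp only [hq]; ring)
    have hq' : HasDerivAt (fun θ => q θ x) (p θ x) θ := by
      have := ((Real.hasDerivAt_sin θ).mul_const (x i)).add
        ((Real.hasDerivAt_cos θ).mul_const (x j))
      exact this.congr_deriv (by simp only [hp]; ring)
    have he := (((((hq'.pow 2).sub_const (x j ^ 2)).const_mul (μ j - μ i)).const_add
      (S x)).const_mul t).exp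
    refine ((hp'.mul hq').mul he).congr_deriv ?_
    simp only [hF', Pi.mul_apply, Pi.pow_apply]
    push_cast
    ring
  have hconst : ∀ θ, ∫ x, F θ x ∂(sphereUniform d) = ∫ x, F 0 x ∂(sphereUniform d) := by
    intro θ
    conv_rhs => rw [← sphereUniform_map_linearIsometryEquiv (planeRotation hij θ)]
    rw [integral_map (planeRotation hij θ).continuous.measurable.aemeasurable
      (hFc 0).aestronglyMeasurable]
    refine integral_congr_ae (.of_forall fun x => ?_)
    simp only [hF, hrot]
    simp only [hp, hq, Real.cos_zero, Real.sin_zero]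
    simp only [planeRotation_apply, if_pos, if_neg hij.symm]
    ring_nf
  -- Crude bounds: only a dominating constant uniform in θ is needed to differentiate under the
  -- integral.
  have hp_le : ∀ θ x, ‖x‖ = 1 → |p θ x| ≤ 2 := fun θ x hx => by
    refine (abs_sub _ _).trans ?_
    rw [abs_mul, abs_mul]
    nlinarith [abs_coord_le hx i, abs_coord_le hx j, Real.abs_cos_le_one θ, Real.abs_sin_le_one θ,
      abs_nonneg (x i), abs_nonneg (x j), abs_nonneg (Real.cos θ), abs_nonneg (Real.sin θ)]
  have hq_le : ∀ θ x, ‖x‖ = 1 → |q θ x| ≤ 2 := fun θ x hx => by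
    refine (abs_add_le _ _).trans ?_
    rw [abs_mul, abs_mul]
    nlinarith [abs_coord_le hx i, abs_coord_le hx j, Real.abs_cos_le_one θ, Real.abs_sin_le_one θ,
      abs_nonneg (x i), abs_nonneg (x j), abs_nonneg (Real.cos θ), abs_nonneg (Real.sin θ)]
  have sq_le : ∀ {a b : ℝ}, |a| ≤ b → a ^ 2 ≤ b ^ 2 := fun h =>
    sq_le_sq' (abs_le.1 h).1 (abs_le.1 h).2
  have hbound : ∀ θ x, ‖x‖ = 1 → ‖F' θ x‖ ≤ (4 + |2 * t * (μ j - μ i)| * 16) *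
      Real.exp (|t| * (∑ k, |μ k| + |μ j - μ i| * 4)) := by
    intro θ x hx
    have h1 := sq_le (hp_le θ x hx)
    have h2 := sq_le (hq_le θ x hx)
    have h3 := sq_le (abs_coord_le hx j)
    have hSx : |S x| ≤ ∑ k, |μ k| := by
      refine (Finset.abs_sum_le_sum_abs _ _).trans (Finset.sum_le_sum fun k _ => ?_)
      rw [abs_mul, abs_of_nonneg (sq_nonneg (x k))]
      exact mul_le_of_le_one_right (abs_nonneg _) (by simpa using sq_le (abs_coord_le hx k))
    have h4 : |q θ x ^ 2 - x j ^ 2| ≤ 4 := by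
      rw [abs_le]; constructor <;> nlinarith [sq_nonneg (q θ x), sq_nonneg (x j)]
    have h5 : |p θ x ^ 2 - q θ x ^ 2| ≤ 4 := by
      rw [abs_le]; constructor <;> nlinarith [sq_nonneg (q θ x), sq_nonneg (p θ x)]
    rw [Real.norm_eq_abs, abs_mul, Real.abs_exp]
    refine mul_le_mul ?_ (Real.exp_le_exp.2 ?_) (Real.exp_pos _).le (by positivity)
    · refine (abs_add_le _ _).trans ?_
      rw [abs_mul, abs_of_nonneg (by positivity : 0 ≤ p θ x ^ 2 * q θ x ^ 2)]
      gcongr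
      nlinarith [sq_nonneg (q θ x), sq_nonneg (p θ x)]
    · refine (le_abs_self _).trans ?_
      rw [abs_mul]
      gcongr
      refine (abs_add_le _ _).trans ?_
      rw [abs_mul]
      gcongr
  have key := (hasDerivAt_integral_of_dominated_loc_of_deriv_le (μ := sphereUniform d)
    (F := F) (F' := F') (x₀ := 0) Filter.univ_mem (.of_forall fun θ => (hFc θ).aestronglyMeasurable)
    (integrable_sphereUniform_of_continuous hd (hFc 0)) (hFc' 0).aestronglyMeasurable
    (by filter_upwards [ae_norm_eq_one_sphereUniform d] with x hx θ _ using hbound θ x hx)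
    (integrable_const _) (.of_forall fun x θ _ => hder x θ)).2
  rw [funext hconst] at key
  have h0 := key.unique (hasDerivAt_const 0 _)
  rw [← h0]
  refine integral_congr_ae (.of_forall fun x => ?_)
  simp [hF', hp, hq, hS]

/-- Stein's identity for `x ↦ ∑ k, μ k * x k ^ 2` on the sphere. -/
lemma integral_centered_mul_exp {d : ℕ} (hd : 0 < d) (μ : Fin d → ℝ) (t : ℝ) :
    d * ∫ x, (∑ k, μ k * x k ^ 2 - (d : ℝ)⁻¹ * ∑ k, μ k) *
        Real.exp (t * ∑ k, μ k * x k ^ 2) ∂(sphereUniform d) =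
      2 * t * ∫ x, (∑ k, μ k ^ 2 * x k ^ 2 - (∑ k, μ k * x k ^ 2) ^ 2) *
        Real.exp (t * ∑ k, μ k * x k ^ 2) ∂(sphereUniform d) := by
  have hd' : (d : ℝ) ≠ 0 := by positivity
  have hI : ∀ {g : EuclideanSpace ℝ (Fin d) → ℝ}, Continuous g → Integrable g (sphereUniform d) :=
    integrable_sphereUniform_of_continuous hd
  have h0 : ∀ i j, ∫ x, (μ j - μ i) * ((x i ^ 2 - x j ^ 2 +
      2 * t * (μ j - μ i) * (x i ^ 2 * x j ^ 2)) *
      Real.exp (t * ∑ k, μ k * x k ^ 2)) ∂(sphereUniform d) = 0 := by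
    intro i j
    rw [integral_const_mul]
    rcases eq_or_ne i j with rfl | hij
    · simp
    · rw [integral_rotation_generator_eq_zero hd hij, mul_zero]
  have hsum : ∫ x, ∑ i, ∑ j, (μ j - μ i) * ((x i ^ 2 - x j ^ 2 +
      2 * t * (μ j - μ i) * (x i ^ 2 * x j ^ 2)) *
      Real.exp (t * ∑ k, μ k * x k ^ 2)) ∂(sphereUniform d) = 0 := by
    rw [integral_finsetSum _ fun i _ => hI (by fun_prop)]
    refine Finset.sum_eq_zero fun i _ => ?_
    rw [integral_finsetSum _ fun j _ => hI (by fun_prop)]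
    exact Finset.sum_eq_zero fun j _ => h0 i j
  have hexp : ∀ᵐ x ∂(sphereUniform d), ∑ i, ∑ j, (μ j - μ i) * ((x i ^ 2 - x j ^ 2 +
      2 * t * (μ j - μ i) * (x i ^ 2 * x j ^ 2)) * Real.exp (t * ∑ k, μ k * x k ^ 2)) =
      2 * (2 * t * ((∑ k, μ k ^ 2 * x k ^ 2 - (∑ k, μ k * x k ^ 2) ^ 2) *
        Real.exp (t * ∑ k, μ k * x k ^ 2))) -
      2 * (d * ((∑ k, μ k * x k ^ 2 - (d : ℝ)⁻¹ * ∑ k, μ k) *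
        Real.exp (t * ∑ k, μ k * x k ^ 2))) := by
    filter_upwards [ae_norm_eq_one_sphereUniform d] with x hx
    have hx1 : ∑ k, x k ^ 2 = 1 := by
      have := EuclideanSpace.real_norm_sq_eq x
      rw [← this, hx, one_pow]
    have hdist : ∀ a b : Fin d → ℝ, ∑ i, ∑ j, a i * b j = (∑ i, a i) * ∑ j, b j := fun a b => by
      rw [Finset.sum_mul_sum]
    generalize Real.exp (t * ∑ k, μ k * x k ^ 2) = e
    -- The factors 1 put every double sum in the form that `hdist` factors; their sums produce d,
    -- while ∑ x_k² = 1 removes the rest.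
    calc _ = ((∑ i, ∑ j, x i ^ 2 * μ j - ∑ i : Fin d, ∑ j, 1 * (μ j * x j ^ 2)
            - ∑ i, ∑ j : Fin d, (μ i * x i ^ 2) * 1 + ∑ i, ∑ j, μ i * x j ^ 2)
          + 2 * t * (∑ i, ∑ j, x i ^ 2 * (μ j ^ 2 * x j ^ 2)
            - 2 * ∑ i, ∑ j, (μ i * x i ^ 2) * (μ j * x j ^ 2)
            + ∑ i, ∑ j, (μ i ^ 2 * x i ^ 2) * x j ^ 2))
          * e := by
          simp only [← Finset.sum_sub_distrib, ← Finset.sum_add_distrib, Finset.mul_sum,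
            Finset.sum_mul]
          refine Finset.sum_congr rfl fun i _ => Finset.sum_congr rfl fun j _ => ?_
          ring
      _ = _ := by
          simp only [hdist]
          simp only [hx1, Finset.sum_const, Finset.card_univ, Fintype.card_fin, nsmul_eq_mul]
          field_simp
          ring
  rw [integral_congr_ae hexp, integral_sub (hI (by fun_prop)) (hI (by fun_prop))] at hsum
  simp only [integral_const_mul] at hsum
  linarith

/-- A Grönwall-type bound. -/
lemma le_exp_of_deriv_le_mul {φ φ' : ℝ → ℝ} {c : ℝ} (h : ∀ t, HasDerivAt φ (φ' t) t)
    (h0 : φ 0 ≤ 1) (hle : ∀ t, 0 ≤ t → φ' t ≤ c * t * φ t) {t : ℝ} (ht : 0 ≤ t) :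
    φ t ≤ Real.exp (c * t ^ 2 / 2) := by
  have hder : ∀ s, HasDerivAt (fun s => φ s * Real.exp (-(c * s ^ 2 / 2)))
      ((φ' s - c * s * φ s) * Real.exp (-(c * s ^ 2 / 2))) s := by
    intro s
    have he := ((((hasDerivAt_id s).pow 2).const_mul c).div_const 2).neg.exp
    refine ((h s).mul he).congr_deriv ?_
    simp
    ring
  have hanti : AntitoneOn (fun s => φ s * Real.exp (-(c * s ^ 2 / 2))) (Set.Ici 0) := by
    refine antitoneOn_of_deriv_nonpos (convex_Ici 0)
      (fun s _ => (hder s).continuousAt.continuousWithinAt)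
      (fun s _ => (hder s).differentiableAt.differentiableWithinAt) fun s hs => ?_
    rw [(hder s).deriv]
    rw [interior_Ici] at hs
    exact mul_nonpos_of_nonpos_of_nonneg (by linarith [hle s hs.le]) (Real.exp_pos _).le
  have := hanti (Set.mem_Ici.2 le_rfl) ht ht
  simp only [Real.exp_neg] at this
  rw [← div_eq_mul_inv, div_le_iff₀ (Real.exp_pos _)] at this
  refine this.trans ?_
  simp only [ne_eq, OfNat.ofNat_ne_zero, not_false_eq_true, zero_pow, mul_zero, zero_div,
    Real.exp_zero, inv_one, mul_one]
  exact mul_le_of_le_one_left (Real.exp_pos _).le h0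

/-- Half of the sub-Gaussian bound for diagonal quadratic forms on the sphere. -/
lemma mgf_diagonal_le_of_nonneg {d : ℕ} (hd : 0 < d) {μ : Fin d → ℝ} {F : ℝ}
    (hμ : ∀ k, |μ k| ≤ F) {t : ℝ} (ht : 0 ≤ t) :
    mgf (fun x : EuclideanSpace ℝ (Fin d) => ∑ k, μ k * x k ^ 2 - (d : ℝ)⁻¹ * ∑ k, μ k)
      (sphereUniform d) t ≤ Real.exp (2 * F ^ 2 / d * t ^ 2 / 2) := by
  have := isProbabilityMeasure_sphereUniform hd
  have hd' : (0 : ℝ) < d := by positivity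
  have hI : ∀ {g : EuclideanSpace ℝ (Fin d) → ℝ}, Continuous g → Integrable g (sphereUniform d) :=
    integrable_sphereUniform_of_continuous hd
  set a := (d : ℝ)⁻¹ * ∑ k, μ k with ha
  set X := fun x : EuclideanSpace ℝ (Fin d) => ∑ k, μ k * x k ^ 2 - a with hX
  have hset : integrableExpSet X (sphereUniform d) = Set.univ := by
    refine Set.eq_univ_of_forall fun s => hI ?_
    simp only [hX]
    fun_prop
  refine le_exp_of_deriv_le_mul (φ := mgf X (sphereUniform d))
    (fun s => hasDerivAt_mgf (by simp [hset])) (by simp) (fun s hs => ?_) ht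
  have hsplit : ∀ x, Real.exp (s * X x) =
      Real.exp (-(s * a)) * Real.exp (s * ∑ k, μ k * x k ^ 2) := fun x => by
    rw [← Real.exp_add]; congr 1; simp only [hX]; ring
  have h1 : d * ∫ x, X x * Real.exp (s * X x) ∂(sphereUniform d) =
      2 * s * ∫ x, (∑ k, μ k ^ 2 * x k ^ 2 - (∑ k, μ k * x k ^ 2) ^ 2) *
        Real.exp (s * X x) ∂(sphereUniform d) := by
    have := integral_centered_mul_exp hd μ s
    simp only [hsplit, mul_left_comm _ (Real.exp (-(s * a))), integral_const_mul]
    simp only [hX]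
    linear_combination Real.exp (-(s * a)) * this
  have h2 : ∫ x, (∑ k, μ k ^ 2 * x k ^ 2 - (∑ k, μ k * x k ^ 2) ^ 2) *
      Real.exp (s * X x) ∂(sphereUniform d) ≤ F ^ 2 * mgf X (sphereUniform d) s := by
    rw [mgf, ← integral_const_mul]
    refine integral_mono_ae (hI (by simp only [hX]; fun_prop)) (hI (by simp only [hX]; fun_prop)) ?_
    filter_upwards [ae_norm_eq_one_sphereUniform d] with x hx
    refine mul_le_mul_of_nonneg_right ?_ (Real.exp_pos _).le
    have hx1 : ∑ k, x k ^ 2 = 1 := by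
      rw [← EuclideanSpace.real_norm_sq_eq x, hx, one_pow]
    -- The other term, -(∑ μ_k x_k²)², is nonpositive and is dropped.
    have : ∑ k, μ k ^ 2 * x k ^ 2 ≤ ∑ k, F ^ 2 * x k ^ 2 := by
      refine Finset.sum_le_sum fun k _ => mul_le_mul_of_nonneg_right ?_ (sq_nonneg _)
      exact sq_le_sq' (abs_le.1 (hμ k)).1 (abs_le.1 (hμ k)).2
    rw [← Finset.mul_sum, hx1, mul_one] at this
    linarith [sq_nonneg (∑ k, μ k * x k ^ 2)]
  have h3 : ∫ x, X x * Real.exp (s * X x) ∂(sphereUniform d) = 2 * s / d *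
      ∫ x, (∑ k, μ k ^ 2 * x k ^ 2 - (∑ k, μ k * x k ^ 2) ^ 2) *
        Real.exp (s * X x) ∂(sphereUniform d) := by
    rw [div_mul_eq_mul_div, eq_div_iff hd'.ne', mul_comm, h1]
  rw [h3]
  calc _ ≤ 2 * s / d * (F ^ 2 * mgf X (sphereUniform d) s) := by gcongr
    _ = _ := by ring

/-- Diagonal quadratic forms on the sphere of `ℝ ^ d` are sub-Gaussian with a variance proxy of
order `1 / d`. -/
lemma hasSubgaussianMGF_diagonal {d : ℕ} (hd : 0 < d) {μ : Fin d → ℝ} {F : ℝ}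
    (hμ : ∀ k, |μ k| ≤ F) :
    HasSubgaussianMGF
      (fun x : EuclideanSpace ℝ (Fin d) => ∑ k, μ k * x k ^ 2 - (d : ℝ)⁻¹ * ∑ k, μ k)
      (2 * F ^ 2 / d).toNNReal (sphereUniform d) where
  integrable_exp_mul t := integrable_sphereUniform_of_continuous hd (by fun_prop)
  mgf_le t := by
    rw [Real.coe_toNNReal _ (by positivity)]
    rcases le_total 0 t with ht | ht
    · exact mgf_diagonal_le_of_nonneg hd hμ ht
    -- Negative t is the positive case for -μ.
    · have := mgf_diagonal_le_of_nonneg hd (μ := fun k => -μ k) (F := F)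
        (by simpa using hμ) (neg_nonneg.2 ht)
      convert this using 1
      · rw [← mgf_neg]
        congr 1
        ext x
        simp
        ring
      · simp

/-! ### The Lanczos algorithm -/

section LanczosLemmas

variable {d : ℕ} (A : Matrix (Fin d) (Fin d) ℝ) (b : EuclideanSpace ℝ (Fin d))

/-- No breakdown hypothesis is needed: if z = 0, both sides vanish. The three-term recurrence
therefore holds at every index. -/
lemma lanczosBeta_smul_lanczosVec_succ (n : ℕ) :
    lanczosBeta A b n • lanczosVec A b (n + 1) =
      Matrix.toEuclideanLin A (lanczosVec A b n)
        - (lanczosState A b n).1 • (lanczosState A b n).2.1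
        - lanczosAlpha A b n • lanczosVec A b n := by
  set z := Matrix.toEuclideanLin A (lanczosVec A b n)
        - (lanczosState A b n).1 • (lanczosState A b n).2.1
        - lanczosAlpha A b n • lanczosVec A b n with hz
  have h1 : lanczosBeta A b n = ‖z‖ := rfl
  have h2 : lanczosVec A b (n + 1) = ‖z‖⁻¹ • z := rfl
  rw [h1, h2]
  rcases eq_or_ne z 0 with h | h
  · simp [h]
  · rw [smul_smul, mul_inv_cancel₀ (norm_ne_zero_iff.2 h), one_smul]

lemma norm_lanczosVec_succ {n : ℕ} (h : lanczosBeta A b n ≠ 0) : ‖lanczosVec A b (n + 1)‖ = 1 := by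
  set z := Matrix.toEuclideanLin A (lanczosVec A b n)
        - (lanczosState A b n).1 • (lanczosState A b n).2.1
        - lanczosAlpha A b n • lanczosVec A b n with hz
  have h1 : lanczosBeta A b n = ‖z‖ := rfl
  have h2 : lanczosVec A b (n + 1) = ‖z‖⁻¹ • z := rfl
  rw [h2, norm_smul, norm_inv, norm_norm]
  exact inv_mul_cancel₀ (h1 ▸ h)

lemma toEuclideanLin_lanczosVec_zero :
    Matrix.toEuclideanLin A (lanczosVec A b 0) =
      lanczosAlpha A b 0 • lanczosVec A b 0 + lanczosBeta A b 0 • lanczosVec A b 1 := by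
  rw [lanczosBeta_smul_lanczosVec_succ]
  simp [lanczosState]

lemma toEuclideanLin_lanczosVec_succ (n : ℕ) :
    Matrix.toEuclideanLin A (lanczosVec A b (n + 1)) =
      lanczosBeta A b n • lanczosVec A b n + lanczosAlpha A b (n + 1) • lanczosVec A b (n + 1)
        + lanczosBeta A b (n + 1) • lanczosVec A b (n + 2) := by
  rw [lanczosBeta_smul_lanczosVec_succ A b (n + 1)]
  have h : (lanczosState A b (n + 1)).1 • (lanczosState A b (n + 1)).2.1 =
      lanczosBeta A b n • lanczosVec A b n := rfl
  rw [h]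
  abel

/-- The inner product of `q_i` with `A q_j` when the Lanczos vectors involved satisfy the
orthonormality relations. -/
lemma inner_toEuclideanLin_lanczosVec {i j : ℕ}
    (h : ∀ l ≤ j, inner ℝ (lanczosVec A b i) (lanczosVec A b l) = if i = l then (1 : ℝ) else 0) :
    inner ℝ (lanczosVec A b i) (Matrix.toEuclideanLin A (lanczosVec A b j)) =
      (if i + 1 = j then lanczosBeta A b i else 0) + (if i = j then lanczosAlpha A b i else 0)
        + lanczosBeta A b j * inner ℝ (lanczosVec A b i) (lanczosVec A b (j + 1)) := by
  cases j with
  | zero =>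
    rw [toEuclideanLin_lanczosVec_zero, inner_add_right, inner_smul_right, inner_smul_right,
      h 0 le_rfl]
    by_cases hi : i = 0 <;> simp [hi]
  | succ n =>
    rw [toEuclideanLin_lanczosVec_succ, inner_add_right, inner_add_right, inner_smul_right,
      inner_smul_right, inner_smul_right, h _ le_rfl, h n (by omega)]
    by_cases hi : i = n
    · subst hi; simp
    · by_cases hi' : i = n + 1 <;> simp [hi, hi']

variable {A b}

lemma inner_toEuclideanLin_comm (hA : A.IsHermitian) (x y : EuclideanSpace ℝ (Fin d)) :
    inner ℝ x (Matrix.toEuclideanLin A y) = inner ℝ (Matrix.toEuclideanLin A x) y :=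
  ((isSymmetric_toEuclideanLin_iff.2 hA) x y).symm

/-- The Lanczos vectors are orthonormal until the algorithm breaks down. -/
lemma inner_lanczosVec (hA : A.IsHermitian) (hb : b ≠ 0) {n : ℕ}
    (hn : ∀ j < n, lanczosBeta A b j ≠ 0) :
    ∀ i ≤ n, ∀ j ≤ n, inner ℝ (lanczosVec A b i) (lanczosVec A b j) =
      if i = j then (1 : ℝ) else 0 := by
  induction n with
  | zero =>
    intro i hi j hj
    obtain rfl : i = 0 := by omega
    obtain rfl : j = 0 := by omega
    have : ‖lanczosVec A b 0‖ = 1 := by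
      change ‖‖b‖⁻¹ • b‖ = 1
      rw [norm_smul, norm_inv, norm_norm, inv_mul_cancel₀ (norm_ne_zero_iff.2 hb)]
    simp [this]
  | succ n ih =>
    replace ih := ih fun j hj => hn j (by omega)
    have key : ∀ i ≤ n, inner ℝ (lanczosVec A b i) (lanczosVec A b (n + 1)) = 0 := by
      intro i hi
      have h := inner_toEuclideanLin_lanczosVec A b (i := i) (j := n) fun l hl => ih i hi l hl
      have hβ := hn n (by omega)
      rcases hi.eq_or_lt with rfl | hlt
      -- For i = n, the choice of α_n is exactly what makes z orthogonal to q_n.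
      · have hα : lanczosAlpha A b i = inner ℝ (lanczosVec A b i)
            (lanczosAlpha A b i • lanczosVec A b i
              + lanczosBeta A b i • lanczosVec A b (i + 1)) := by
          rw [lanczosBeta_smul_lanczosVec_succ, add_sub_cancel]
          rfl
        rw [inner_add_right, inner_smul_right, inner_smul_right, ih i le_rfl i le_rfl, if_pos rfl,
          mul_one, left_eq_add] at hα
        exact (mul_eq_zero.1 hα).resolve_left hβ
      -- For i < n, expand ⟨q_i, A q_n⟩ = ⟨A q_i, q_n⟩ by the recurrence on either side: the β_i
      -- terms (present only if i + 1 = n) cancel, leaving β_n ⟨q_i, q_{n+1}⟩ = 0.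
      · rw [inner_toEuclideanLin_comm hA, real_inner_comm,
          inner_toEuclideanLin_lanczosVec A b (i := n) (j := i)
            fun l hl => ih n le_rfl l (by omega), ih n le_rfl (i + 1) hlt] at h
        rw [if_neg (by omega), if_neg (by omega), if_neg (by omega : ¬ i = n)] at h
        have h0 : lanczosBeta A b n *
            inner ℝ (lanczosVec A b i) (lanczosVec A b (n + 1)) = 0 := by
          by_cases hi' : i + 1 = n
          · subst hi'
            simp at h
            simpa using h
          · rw [if_neg hi', if_neg (Ne.symm hi')] at h
            linarith
        exact (mul_eq_zero.1 h0).resolve_left hβ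
    intro i hi j hj
    rcases hi.eq_or_lt with rfl | hi'
    · rcases hj.eq_or_lt with rfl | hj'
      · simp [norm_lanczosVec_succ A b (hn n (by omega))]
      · rw [real_inner_comm, key j (by omega), if_neg (by omega)]
    · rcases hj.eq_or_lt with rfl | hj'
      · rw [key i (by omega), if_neg (by omega)]
      · exact ih i (by omega) j (by omega)

lemma lanczosTridiag_isHermitian (r : ℕ) : (lanczosTridiag A b r).IsHermitian := by
  ext i j
  simp only [conjTranspose_apply, lanczosTridiag, of_apply, star_trivial]
  rcases eq_or_ne i j with rfl | hij
  · rfl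
  · rw [if_neg hij.symm, if_neg hij]
    split_ifs <;> first | rfl | omega

/-- `A` compressed to the span of the Lanczos vectors is the tridiagonal Lanczos matrix. -/
lemma inner_lanczosVec_eq_lanczosTridiag (hA : A.IsHermitian) (hb : b ≠ 0) {r : ℕ}
    (hr : ∀ j, j + 1 < r → lanczosBeta A b j ≠ 0) (i j : Fin r) :
    inner ℝ (lanczosVec A b i) (Matrix.toEuclideanLin A (lanczosVec A b j)) =
      lanczosTridiag A b r i j := by
  have horth := inner_lanczosVec hA hb (n := r - 1) fun j hj => hr j (by omega)
  rw [inner_toEuclideanLin_lanczosVec A b fun l hl => horth i (by omega) l (by omega)]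
  -- For j = r - 1 the vector q_r may come after a breakdown and fail to be a unit vector; then its
  -- coefficient β_j is zero. Otherwise orthonormality extends to index j + 1.
  have hlast : lanczosBeta A b j * inner ℝ (lanczosVec A b i) (lanczosVec A b (j + 1)) =
      if (j : ℕ) + 1 = i then lanczosBeta A b j else 0 := by
    by_cases h0 : lanczosBeta A b j = 0
    · simp [h0]
    · have horth' := inner_lanczosVec hA hb (n := max (r - 1) (j + 1)) fun l hl => by
        rcases eq_or_ne l j with rfl | hlj
        · exact h0
        · exact hr l (by omega)
      rw [horth' i (by omega) (j + 1) (by omega), mul_ite, mul_one, mul_zero]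
      simp only [eq_comm]
  rw [hlast]
  simp only [lanczosTridiag, of_apply, Fin.ext_iff]
  split_ifs <;> first | omega | simp

/-- The linear combination of the first `r` Lanczos vectors with coefficients `v`. -/
noncomputable def lanczosCombination (A : Matrix (Fin d) (Fin d) ℝ) (b : EuclideanSpace ℝ (Fin d))
    {r : ℕ} (v : Fin r → ℝ) : EuclideanSpace ℝ (Fin d) :=
  ∑ i, v i • lanczosVec A b i

lemma inner_lanczosCombination (hA : A.IsHermitian) (hb : b ≠ 0) {r : ℕ}
    (hr : ∀ j, j + 1 < r → lanczosBeta A b j ≠ 0) (u v : Fin r → ℝ) :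
    inner ℝ (lanczosCombination A b u) (lanczosCombination A b v) = u ⬝ᵥ v := by
  have horth := inner_lanczosVec hA hb (n := r - 1) fun j hj => hr j (by omega)
  simp only [lanczosCombination, sum_inner, inner_sum, real_inner_smul_left, inner_smul_right]
  refine Finset.sum_congr rfl fun i _ => ?_
  rw [Finset.sum_eq_single i]
  · rw [horth i (by omega) i (by omega), if_pos rfl]
    ring
  · intro j _ hj
    rw [horth _ (by omega) _ (by omega), if_neg (by simpa [Fin.ext_iff] using hj)]
    ring
  · simp

lemma inner_lanczosCombination_toEuclideanLin (hA : A.IsHermitian) (hb : b ≠ 0) {r : ℕ}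
    (hr : ∀ j, j + 1 < r → lanczosBeta A b j ≠ 0) (u v : Fin r → ℝ) :
    inner ℝ (lanczosCombination A b u) (Matrix.toEuclideanLin A (lanczosCombination A b v)) =
      u ⬝ᵥ (lanczosTridiag A b r *ᵥ v) := by
  simp only [lanczosCombination, map_sum, map_smul, sum_inner, inner_sum, real_inner_smul_left,
    inner_smul_right, inner_lanczosVec_eq_lanczosTridiag hA hb hr, dotProduct, mulVec]
  simp only [Finset.mul_sum]
  rw [Finset.sum_comm]
  refine Finset.sum_congr rfl fun i _ => ?_
  exact Finset.sum_congr rfl fun j _ => by ring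

lemma toEuclideanLin_lanczosVec_eq_sum {r : ℕ} (j : Fin r)
    (hj : (j : ℕ) + 1 < r ∨ lanczosBeta A b j = 0) :
    Matrix.toEuclideanLin A (lanczosVec A b j) =
      ∑ i, lanczosTridiag A b r i j • lanczosVec A b i := by
  have hT : ∀ i : Fin r, lanczosTridiag A b r i j • lanczosVec A b i =
      (if (i : ℕ) + 1 = j then lanczosBeta A b i • lanczosVec A b i else 0)
      + (if (i : ℕ) = j then lanczosAlpha A b i • lanczosVec A b i else 0)
      + (if (i : ℕ) = j + 1 then lanczosBeta A b j • lanczosVec A b (j + 1) else 0) := by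
    rintro ⟨i, hi⟩
    obtain ⟨j, hjr⟩ := j
    simp only [lanczosTridiag, of_apply, Fin.ext_iff]
    split_ifs <;> first | omega | (subst_vars; simp)
  simp only [hT, Finset.sum_add_distrib]
  rw [Fin.sum_univ_eq_sum_range
      (fun i => if i + 1 = (j : ℕ) then lanczosBeta A b i • lanczosVec A b i else 0),
    Fin.sum_univ_eq_sum_range
      (fun i => if i = (j : ℕ) then lanczosAlpha A b i • lanczosVec A b i else 0),
    Fin.sum_univ_eq_sum_range
      (fun i => if i = (j : ℕ) + 1 then lanczosBeta A b j • lanczosVec A b (j + 1) else 0),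
    Finset.sum_ite_eq', Finset.sum_ite_eq', if_pos (by simp)]
  have hlast : (if (j : ℕ) + 1 ∈ Finset.range r then lanczosBeta A b j • lanczosVec A b (j + 1)
      else 0) = lanczosBeta A b j • lanczosVec A b (j + 1) := by
    rcases hj with h | h
    · rw [if_pos (by simpa using h)]
    · simp [h]
  rw [hlast]
  obtain ⟨j, hjr⟩ := j
  cases j with
  | zero => simp [toEuclideanLin_lanczosVec_zero]
  | succ n =>
    simp only [add_left_inj, Finset.sum_ite_eq']
    rw [if_pos (by simp; omega), toEuclideanLin_lanczosVec_succ]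

/-- AQ = QT up to the remainder β_{r-1} q_r in the last column, which disappears if the algorithm
broke down there or if v has no last component. -/
lemma toEuclideanLin_lanczosCombination {r : ℕ} {v : Fin r → ℝ}
    (hv : ∀ j : Fin r, (j : ℕ) + 1 < r ∨ lanczosBeta A b j = 0 ∨ v j = 0) :
    Matrix.toEuclideanLin A (lanczosCombination A b v) =
      lanczosCombination A b (lanczosTridiag A b r *ᵥ v) := by
  simp only [lanczosCombination, map_sum, map_smul, mulVec, dotProduct, Finset.sum_smul]
  rw [Finset.sum_comm]
  refine Finset.sum_congr rfl fun j _ => ?_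
  simp only [mul_comm _ (v j), mul_smul, ← Finset.smul_sum]
  rcases eq_or_ne (v j) 0 with h | h
  · simp [h]
  · rw [toEuclideanLin_lanczosVec_eq_sum j ((hv j).imp_right fun h' => h'.resolve_right h)]

/-- The first unit vector of `ℝ ^ r`. -/
def firstUnitVec (r : ℕ) : Fin r → ℝ := fun i => if (i : ℕ) = 0 then 1 else 0

/-- A tridiagonal matrix enlarges the support by at most one index per application. -/
lemma lanczosTridiag_pow_mulVec_eq_zero {r : ℕ} (n : ℕ) (i : Fin r) (hi : n < i) :
    (lanczosTridiag A b r ^ n *ᵥ firstUnitVec r) i = 0 := by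
  induction n generalizing i with
  | zero => simp [firstUnitVec, hi.ne']
  | succ n ih =>
    rw [pow_succ', ← mulVec_mulVec]
    refine Finset.sum_eq_zero (s := (Finset.univ : Finset (Fin r))) fun j _ => ?_
    by_cases hj : n < j
    · rw [ih j hj, mul_zero]
    · have : lanczosTridiag A b r i j = 0 := by
        simp only [lanczosTridiag, of_apply, Fin.ext_iff]
        split_ifs <;> first | omega | rfl
      exact mul_eq_zero_of_left this _

/-- Below power r the iterates of e₁ reach the last coordinate too late for the remainder in AQ = QT
to matter; after a breakdown the span is invariant and all powers are allowed. -/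
lemma toEuclideanLin_pow_lanczosVec_zero {r : ℕ} (hr : 0 < r) {n : ℕ}
    (hn : n < r ∨ lanczosBeta A b (r - 1) = 0) :
    Matrix.toEuclideanLin (A ^ n) (lanczosVec A b 0) =
      lanczosCombination A b (lanczosTridiag A b r ^ n *ᵥ firstUnitVec r) := by
  induction n with
  | zero =>
    rw [pow_zero, pow_zero, one_mulVec, lanczosCombination,
      Finset.sum_eq_single (⟨0, hr⟩ : Fin r)]
    · simp [firstUnitVec]
    · intro i _ hi
      have : (i : ℕ) ≠ 0 := by simpa [Fin.ext_iff] using hi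
      simp [firstUnitVec, this]
    · simp
  | succ n ih =>
    have h : Matrix.toEuclideanLin (A ^ (n + 1)) (lanczosVec A b 0) =
        Matrix.toEuclideanLin A (Matrix.toEuclideanLin (A ^ n) (lanczosVec A b 0)) := by
      simp [toLpLin_apply, pow_succ']
    rw [h, ih (hn.imp_left fun h => by omega), toEuclideanLin_lanczosCombination, mulVec_mulVec,
      pow_succ']
    intro j
    by_cases hj : (j : ℕ) + 1 < r
    · exact Or.inl hj
    · have hj' : (j : ℕ) = r - 1 := by omega
      rcases hn with h | h
      · exact Or.inr (Or.inr (lanczosTridiag_pow_mulVec_eq_zero n j (by omega)))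
      · exact Or.inr (Or.inl (hj' ▸ h))

end LanczosLemmas

/-! ### Quadratic forms of functions of a symmetric matrix -/

lemma isHermitian_of_isSymm {n : ℕ} {A : Matrix (Fin n) (Fin n) ℝ} (hA : A.IsSymm) :
    A.IsHermitian := by
  rw [IsHermitian, conjTranspose_eq_transpose_of_trivial]
  exact hA

/-- The spectrum is finite, so `cfc` diagonalizes in the eigenbasis for arbitrary f, continuous or
not. -/
lemma quadForm_cfc {n : ℕ} {A : Matrix (Fin n) (Fin n) ℝ} (hA : A.IsHermitian) (f : ℝ → ℝ)
    (x : EuclideanSpace ℝ (Fin n)) :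
    quadForm (cfc f A) x = ∑ i, f (hA.eigenvalues i) * hA.eigenvectorBasis.repr x i ^ 2 := by
  have hx : (star (hA.eigenvectorUnitary : Matrix (Fin n) (Fin n) ℝ)) *ᵥ x.ofLp =
      fun i => hA.eigenvectorBasis.repr x i := by
    ext i
    rw [OrthonormalBasis.repr_apply_apply, EuclideanSpace.inner_eq_star_dotProduct]
    simp only [mulVec, dotProduct, star_apply, IsHermitian.eigenvectorUnitary_apply, star_trivial]
    exact Finset.sum_congr rfl fun j _ => mul_comm _ _
  have hx' : x.ofLp ᵥ* (hA.eigenvectorUnitary : Matrix (Fin n) (Fin n) ℝ) =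
      fun i => hA.eigenvectorBasis.repr x i := by
    rw [← hx, star_eq_conjTranspose, conjTranspose_eq_transpose_of_trivial, mulVec_transpose]
  rw [quadForm, hA.cfc_eq, IsHermitian.cfc, Unitary.conjStarAlgAut_apply, ← mulVec_mulVec,
    ← mulVec_mulVec, dotProduct_mulVec, hx', hx]
  simp only [dotProduct, mulVec_diagonal, Function.comp_apply, RCLike.ofReal_real_eq_id, id_eq]
  exact Finset.sum_congr rfl fun i _ => by ring

lemma trace_cfc {n : ℕ} {A : Matrix (Fin n) (Fin n) ℝ} (hA : A.IsHermitian) (f : ℝ → ℝ) :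
    (cfc f A).trace = ∑ i, f (hA.eigenvalues i) := by
  rw [hA.cfc_eq, IsHermitian.cfc, Unitary.conjStarAlgAut_apply, trace_mul_comm, ← mul_assoc,
    Unitary.coe_star_mul_self, one_mul]
  simp [trace]

lemma sum_sq_repr {n : ℕ} (u : OrthonormalBasis (Fin n) ℝ (EuclideanSpace ℝ (Fin n)))
    (x : EuclideanSpace ℝ (Fin n)) : ∑ i, u.repr x i ^ 2 = ‖x‖ ^ 2 := by
  rw [← EuclideanSpace.real_norm_sq_eq, LinearIsometryEquiv.norm_map]

lemma abs_quadForm_cfc_sub_le {n : ℕ} {A : Matrix (Fin n) (Fin n) ℝ} (hA : A.IsHermitian)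
    {f g : ℝ → ℝ} {ε : ℝ} (h : ∀ i, |f (hA.eigenvalues i) - g (hA.eigenvalues i)| ≤ ε)
    (x : EuclideanSpace ℝ (Fin n)) :
    |quadForm (cfc f A) x - quadForm (cfc g A) x| ≤ ε * ‖x‖ ^ 2 := by
  rw [quadForm_cfc hA, quadForm_cfc hA, ← Finset.sum_sub_distrib,
    ← sum_sq_repr hA.eigenvectorBasis, Finset.mul_sum]
  refine (Finset.abs_sum_le_sum_abs _ _).trans (Finset.sum_le_sum fun i _ => ?_)
  rw [← sub_mul, abs_mul, abs_of_nonneg (sq_nonneg (hA.eigenvectorBasis.repr x i))]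
  exact mul_le_mul_of_nonneg_right (h i) (sq_nonneg _)

lemma eigenvalues_mem_spectralInterval {n : ℕ} {A : Matrix (Fin n) (Fin n) ℝ}
    (hA : A.IsHermitian) (i : Fin n) : hA.eigenvalues i ∈ spectralInterval A :=
  ⟨csInf_le A.finite_real_spectrum.bddBelow (hA.eigenvalues_mem_spectrum_real i),
    le_csSup A.finite_real_spectrum.bddAbove (hA.eigenvalues_mem_spectrum_real i)⟩

/-- A Rayleigh quotient is a convex combination of eigenvalues, weighted by squared
eigencoordinates. -/
lemma quadForm_mem_spectralInterval {n : ℕ} {A : Matrix (Fin n) (Fin n) ℝ} (hA : A.IsHermitian)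
    {x : EuclideanSpace ℝ (Fin n)} (hx : ‖x‖ = 1) : quadForm A x ∈ spectralInterval A := by
  have h1 : ∑ i, hA.eigenvectorBasis.repr x i ^ 2 = 1 := by rw [sum_sq_repr, hx, one_pow]
  have h : quadForm A x = ∑ i, hA.eigenvectorBasis.repr x i ^ 2 • hA.eigenvalues i := by
    conv_lhs => rw [← cfc_id ℝ A (show IsSelfAdjoint A from hA)]
    rw [quadForm_cfc hA]
    exact Finset.sum_congr rfl fun i _ => by rw [id, smul_eq_mul, mul_comm]
  rw [h]
  exact (convex_Icc _ _).sum_mem (fun i _ => sq_nonneg _) h1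
    fun i _ => eigenvalues_mem_spectralInterval hA i

lemma cfc_eval {n : ℕ} {A : Matrix (Fin n) (Fin n) ℝ} (hA : A.IsHermitian) (p : ℝ[X]) :
    cfc (fun x => p.eval x) A = aeval A p :=
  cfc_polynomial p A (show IsSelfAdjoint A from hA)

lemma quadForm_aeval {n N : ℕ} (A : Matrix (Fin n) (Fin n) ℝ) {p : ℝ[X]} (hp : p.natDegree < N)
    (x : EuclideanSpace ℝ (Fin n)) :
    quadForm (aeval A p) x = ∑ i ∈ Finset.range N, p.coeff i * quadForm (A ^ i) x := by
  rw [aeval_eq_sum_range' hp, quadForm, sum_mulVec, dotProduct_sum]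
  exact Finset.sum_congr rfl fun i _ => by rw [smul_mulVec, dotProduct_smul, smul_eq_mul, quadForm]

lemma abs_le_supNormOn {S : Set ℝ} {f : ℝ → ℝ} (hf : BddAbove ((fun x => |f x|) '' S)) {x : ℝ}
    (hx : x ∈ S) : |f x| ≤ supNormOn S f :=
  le_csSup hf ⟨x, hx, rfl⟩

/-! ### Concentration of the quadratic trace estimator -/

lemma hasSubgaussianMGF_quadForm {d : ℕ} (hd : 0 < d) {A : Matrix (Fin d) (Fin d) ℝ}
    (hA : A.IsHermitian) {f : ℝ → ℝ} {F : ℝ} (hF : ∀ i, |f (hA.eigenvalues i)| ≤ F) :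
    HasSubgaussianMGF (fun x => quadForm (cfc f A) x - (d : ℝ)⁻¹ * (cfc f A).trace)
      (2 * F ^ 2 / d).toNNReal (sphereUniform d) := by
  have h := hasSubgaussianMGF_diagonal hd hF
  rw [← sphereUniform_map_linearIsometryEquiv hA.eigenvectorBasis.repr] at h
  have h' := h.of_map hA.eigenvectorBasis.repr.continuous.measurable.aemeasurable
  convert h' using 1
  ext x
  rw [quadForm_cfc hA, trace_cfc hA]
  rfl

lemma measure_traceEstimator_deviation_le {d m : ℕ} (hd : 0 < d) (hm : 0 < m)
    {A : Matrix (Fin d) (Fin d) ℝ} (hA : A.IsHermitian) {f : ℝ → ℝ} {F : ℝ}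
    (hF : ∀ i, |f (hA.eigenvalues i)| ≤ F) {δ : ℝ} (hδ : 0 < δ) (hδ1 : δ < 1)
    {Ω : Type*} [MeasurableSpace Ω] {P : Measure Ω} [IsProbabilityMeasure P]
    {b : Fin m → Ω → EuclideanSpace ℝ (Fin d)} (hb : ∀ l, Measurable (b l)) (hind : iIndepFun b P)
    (hlaw : ∀ l, P.map (b l) = sphereUniform d) :
    P {ω | F * √(Real.log (2 / δ) / (1 / 4 * d * m)) <
      |(d : ℝ)⁻¹ * (cfc f A).trace - (m : ℝ)⁻¹ * ∑ l, quadForm (cfc f A) (b l ω)|} ≤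
      ENNReal.ofReal δ := by
  have hd' : (0 : ℝ) < d := by positivity
  have hm' : (0 : ℝ) < m := by positivity
  have hF0 : 0 ≤ F := (abs_nonneg _).trans (hF ⟨0, hd⟩)
  have hlog : 0 < Real.log (2 / δ) := Real.log_pos (by rw [lt_div_iff₀ hδ]; linarith)
  set a := (d : ℝ)⁻¹ * (cfc f A).trace with ha
  set t := F * √(Real.log (2 / δ) / (1 / 4 * d * m)) with ht
  -- For F = 0 the Chernoff exponent would be 0/0; but then the deviation is identically zero and
  -- the strict event is empty.
  rcases hF0.eq_or_lt with hF0 | hFpos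
  · have hz : ∀ i, f (hA.eigenvalues i) = 0 := fun i => by
      have := hF i
      rwa [← hF0, abs_nonpos_iff] at this
    convert zero_le (a := ENNReal.ofReal δ)
    convert measure_empty (μ := P)
    ext ω
    simp [ht, ha, ← hF0, quadForm_cfc hA, trace_cfc hA, hz]
  have ht2 : t ^ 2 = F ^ 2 * (Real.log (2 / δ) / (1 / 4 * d * m)) := by
    rw [ht, mul_pow, Real.sq_sqrt (by positivity)]
  set g : EuclideanSpace ℝ (Fin d) → ℝ := fun x => quadForm (cfc f A) x - a with hg
  have hgm : Measurable g := by
    have : g = fun x => ∑ i, f (hA.eigenvalues i) * hA.eigenvectorBasis.repr x i ^ 2 - a := by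
      ext x; rw [hg]; simp only [quadForm_cfc hA]
    rw [this]
    fun_prop
  have hsub : ∀ l, HasSubgaussianMGF (fun ω => g (b l ω)) (2 * F ^ 2 / d).toNNReal P := fun l => by
    have h := hasSubgaussianMGF_quadForm hd hA hF
    rw [← hlaw l] at h
    exact h.of_map (hb l).aemeasurable
  have hindg : iIndepFun (fun l ω => g (b l ω)) P := hind.comp (fun _ => g) fun _ => hgm
  have hsum := HasSubgaussianMGF.sum_of_iIndepFun hindg (s := Finset.univ) fun l _ => hsub l
  have ht0 : 0 ≤ m * t := by positivity
  -- The sum has proxy 2mF²/d, so the exponent is -dmt²/(4F²). This fixes C = 1/4 and gives each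
  -- tail δ/2.
  have hexp : Real.exp (-(m * t) ^ 2 /
      (2 * ((∑ _l : Fin m, (2 * F ^ 2 / d).toNNReal : NNReal) : ℝ))) = δ / 2 := by
    have : -(m * t) ^ 2 / (2 * ((∑ _l : Fin m, (2 * F ^ 2 / d).toNNReal : NNReal) : ℝ)) =
        -Real.log (2 / δ) := by
      rw [Finset.sum_const, Finset.card_univ, Fintype.card_fin, nsmul_eq_mul, NNReal.coe_mul,
        NNReal.coe_natCast, Real.coe_toNNReal _ (by positivity), mul_pow, ht2]
      field_simp
      ring
    rw [this, Real.exp_neg, Real.exp_log (by positivity), inv_div]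
  have h1 := hsum.measure_ge_le ht0
  have h2 := hsum.neg.measure_ge_le ht0
  rw [hexp] at h1 h2
  have hsubset : {ω | t < |a - (m : ℝ)⁻¹ * ∑ l, quadForm (cfc f A) (b l ω)|} ⊆
      {ω | m * t ≤ ∑ l, g (b l ω)} ∪ {ω | m * t ≤ (-fun ω => ∑ l, g (b l ω)) ω} := by
    intro ω hω
    have hs : ∑ l, g (b l ω) = -(m * (a - (m : ℝ)⁻¹ * ∑ l, quadForm (cfc f A) (b l ω))) := by
      simp only [hg, Finset.sum_sub_distrib, Finset.sum_const, Finset.card_univ, Fintype.card_fin,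
        nsmul_eq_mul]
      field_simp
      ring
    simp only [Set.mem_ofPred_eq, Set.mem_union, Pi.neg_apply, hs, neg_neg] at hω ⊢
    rcases lt_abs.1 hω with h | h
    · exact Or.inr (mul_le_mul_of_nonneg_left h.le hm'.le)
    · rw [← mul_neg]
      exact Or.inl (mul_le_mul_of_nonneg_left h.le hm'.le)
  refine (measure_mono hsubset).trans ?_
  rw [← ofReal_measureReal]
  refine ENNReal.ofReal_le_ofReal ((measureReal_union_le _ _).trans ?_)
  linarith

/-! ### Lanczos quadrature -/

section LanczosQuadrature

variable {d : ℕ} {A : Matrix (Fin d) (Fin d) ℝ} {b : EuclideanSpace ℝ (Fin d)}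

lemma quadForm_eq_inner (M : Matrix (Fin d) (Fin d) ℝ) (x : EuclideanSpace ℝ (Fin d)) :
    quadForm M x = inner ℝ x (Matrix.toEuclideanLin M x) := by
  rw [EuclideanSpace.inner_eq_star_dotProduct, star_trivial, dotProduct_comm]
  rfl

lemma lanczosVec_zero_of_norm_eq_one (hb : ‖b‖ = 1) : lanczosVec A b 0 = b := by
  change ‖b‖⁻¹ • b = b
  rw [hb, inv_one, one_smul]

/-- The indices of executed iterations form an initial segment, ending at the first j with j + 1 < k
and β_j = 0, or else at k - 1. -/
lemma lanczosSteps_spec (A : Matrix (Fin d) (Fin d) ℝ) (b : EuclideanSpace ℝ (Fin d)) {k : ℕ}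
    (hk : 0 < k) :
    0 < lanczosSteps A b k ∧
      (∀ j, j + 1 < lanczosSteps A b k → lanczosBeta A b j ≠ 0) ∧
      (lanczosSteps A b k = k ∨ lanczosBeta A b (lanczosSteps A b k - 1) = 0) := by
  have hcard : ∀ r, (∀ n, (n < k ∧ ∀ j < n, lanczosBeta A b j ≠ 0) ↔ n < r) →
      lanczosSteps A b k = r := by
    intro r h
    rw [lanczosSteps]
    simp only [h]
    exact (Nat.card_congr Fin.equivSubtype.symm).trans (Nat.card_fin r)
  by_cases h : ∃ j, j + 1 < k ∧ lanczosBeta A b j = 0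
  · classical
    have hs := Nat.find_spec h
    have hmin : ∀ l < Nat.find h, lanczosBeta A b l ≠ 0 := fun l hl h0 =>
      Nat.find_min h hl ⟨by omega, h0⟩
    rw [hcard (Nat.find h + 1)]
    · exact ⟨by omega, fun j hj => hmin j (by omega), Or.inr hs.2⟩
    · intro n
      constructor
      · rintro ⟨_, hn⟩
        by_contra hlt
        exact hn _ (by omega) hs.2
      · intro hn
        exact ⟨by omega, fun j hj => hmin j (by omega)⟩
  · push Not at h
    rw [hcard k]
    · exact ⟨hk, h, Or.inl rfl⟩
    · intro n
      exact ⟨fun hn => hn.1, fun hn => ⟨hn, fun j hj => h j (by omega)⟩⟩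

lemma norm_firstUnitVec {r : ℕ} (hr : 0 < r) : ‖WithLp.toLp 2 (firstUnitVec r)‖ = 1 := by
  have : firstUnitVec r = Pi.single (⟨0, hr⟩ : Fin r) 1 := by
    ext i
    simp [firstUnitVec, Pi.single_apply, Fin.ext_iff]
  rw [this, PiLp.toLp_single]
  simp

lemma firstEntry_eq_quadForm (f : ℝ → ℝ) {r : ℕ} (T : Matrix (Fin r) (Fin r) ℝ) :
    firstEntry f T = quadForm (cfc f T) (WithLp.toLp 2 (firstUnitVec r)) := rfl

lemma norm_lanczosCombination (hA : A.IsHermitian) (hb : b ≠ 0) {r : ℕ}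
    (hr : ∀ j, j + 1 < r → lanczosBeta A b j ≠ 0) (v : EuclideanSpace ℝ (Fin r)) :
    ‖lanczosCombination A b v.ofLp‖ = ‖v‖ := by
  refine (sq_eq_sq₀ (norm_nonneg _) (norm_nonneg _)).1 ?_
  rw [← real_inner_self_eq_norm_sq, ← real_inner_self_eq_norm_sq, inner_lanczosCombination hA hb hr,
    EuclideanSpace.inner_eq_star_dotProduct, star_trivial]

/-- The Ritz values lie in the spectral interval. -/
lemma eigenvalues_lanczosTridiag_mem (hA : A.IsHermitian) (hb : b ≠ 0) {r : ℕ}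
    (hr : ∀ j, j + 1 < r → lanczosBeta A b j ≠ 0)
    (hT : (lanczosTridiag A b r).IsHermitian) (i : Fin r) :
    hT.eigenvalues i ∈ spectralInterval A := by
  have hv : ‖hT.eigenvectorBasis i‖ = 1 := hT.eigenvectorBasis.orthonormal.1 i
  have h : hT.eigenvalues i =
      quadForm A (lanczosCombination A b (hT.eigenvectorBasis i).ofLp) := by
    rw [quadForm_eq_inner, inner_lanczosCombination_toEuclideanLin hA hb hr, hT.eigenvalues_eq]
    simp
  rw [h]
  exact quadForm_mem_spectralInterval hA (by rw [norm_lanczosCombination hA hb hr, hv])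

/-- Gauss quadrature: Lanczos matches the first `2k` moments. -/
lemma quadForm_lanczosTridiag_pow (hA : A.IsHermitian) (hb : ‖b‖ = 1) {k r : ℕ}
    (hr0 : 0 < r) (hr : ∀ j, j + 1 < r → lanczosBeta A b j ≠ 0)
    (hrk : r = k ∨ lanczosBeta A b (r - 1) = 0) {n : ℕ} (hn : n < 2 * k) :
    quadForm (lanczosTridiag A b r ^ n) (WithLp.toLp 2 (firstUnitVec r)) = quadForm (A ^ n) b := by
  have hb0 : b ≠ 0 := by
    rintro rfl
    simp at hb
  have hT := lanczosTridiag_isHermitian (A := A) (b := b) r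
  rcases Nat.eq_zero_or_pos n with rfl | hpos
  · rw [pow_zero, pow_zero, quadForm_eq_inner, quadForm_eq_inner]
    simp [norm_firstUnitVec hr0, hb]
  -- The middle factor `A` is absorbed by QᵀAQ = T, so i, j ≤ k - 1 reach every n up to 2k - 1.
  obtain ⟨i, j, hi, hj, rfl⟩ : ∃ i j, i < k ∧ j < k ∧ n = i + (1 + j) :=
    ⟨n / 2, n - 1 - n / 2, by omega, by omega, by omega⟩
  have hAi : (A ^ i).IsHermitian := hA.pow i
  have hTi : (lanczosTridiag A b r ^ i).IsHermitian := hT.pow i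
  have hcomp : ∀ x, Matrix.toEuclideanLin (A ^ (i + (1 + j))) x =
      Matrix.toEuclideanLin (A ^ i) (Matrix.toEuclideanLin A (Matrix.toEuclideanLin (A ^ j) x)) :=
    fun x => by simp [toLpLin_apply, pow_add]
  have hlt : ∀ l < k, l < r ∨ lanczosBeta A b (r - 1) = 0 := fun l hl =>
    hrk.imp_left fun h => by omega
  have hkrylov : ∀ l < k, Matrix.toEuclideanLin (A ^ l) b =
      lanczosCombination A b (lanczosTridiag A b r ^ l *ᵥ firstUnitVec r) := fun l hl => by
    have h := toEuclideanLin_pow_lanczosVec_zero hr0 (hlt l hl)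
    rwa [lanczosVec_zero_of_norm_eq_one hb] at h
  rw [quadForm_eq_inner (A ^ _), hcomp, inner_toEuclideanLin_comm hAi,
    hkrylov i hi, hkrylov j hj,
    inner_lanczosCombination_toEuclideanLin hA hb0 hr]
  rw [quadForm, pow_add, pow_add, pow_one, ← mulVec_mulVec, ← mulVec_mulVec, dotProduct_mulVec,
    ← mulVec_transpose, ← conjTranspose_eq_transpose_of_trivial, hTi.eq]

/-- The error of Lanczos quadrature is at most twice the error of polynomial approximation. -/
lemma abs_quadForm_sub_lanQF_le (hA : A.IsHermitian) (hb : ‖b‖ = 1) {k : ℕ} (hk : 0 < k)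
    {f : ℝ → ℝ} {p : ℝ[X]} (hp : p.degree < ((2 * k : ℕ) : WithBot ℕ)) {ε : ℝ}
    (hε : ∀ x ∈ spectralInterval A, |f x - p.eval x| ≤ ε) :
    |quadForm (cfc f A) b - lanQF A b k f| ≤ 2 * ε := by
  have hb0 : b ≠ 0 := by
    rintro rfl
    simp at hb
  obtain ⟨hr0, hr, hrk⟩ := lanczosSteps_spec A b hk
  set r := lanczosSteps A b k with hrdef
  have hT := lanczosTridiag_isHermitian (A := A) (b := b) r
  have hnat : p.natDegree < 2 * k := by
    rcases eq_or_ne p 0 with rfl | hp0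
    · simpa using hk
    · exact (natDegree_lt_iff_degree_lt hp0).2 hp
  have hexact : quadForm (cfc (fun x => p.eval x) A) b =
      quadForm (cfc (fun x => p.eval x) (lanczosTridiag A b r))
        (WithLp.toLp 2 (firstUnitVec r)) := by
    rw [cfc_eval hA, cfc_eval hT, quadForm_aeval _ hnat, quadForm_aeval _ hnat]
    refine Finset.sum_congr rfl fun n hn => ?_
    rw [quadForm_lanczosTridiag_pow hA hb hr0 hr hrk (Finset.mem_range.1 hn)]
  have h1 := abs_quadForm_cfc_sub_le hA (f := f) (g := fun x => p.eval x)
    (fun i => hε _ (eigenvalues_mem_spectralInterval hA i)) b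
  have h2 := abs_quadForm_cfc_sub_le hT (f := f) (g := fun x => p.eval x)
    (fun i => hε _ (eigenvalues_lanczosTridiag_mem hA hb0 hr hT i))
    (WithLp.toLp 2 (firstUnitVec r))
  rw [norm_firstUnitVec hr0, one_pow, mul_one, ← hexact] at h2
  rw [hb, one_pow, mul_one] at h1
  rw [lanQF, hb, one_pow, one_mul, firstEntry_eq_quadForm, ← hrdef]
  rw [abs_le] at h1 h2 ⊢
  constructor <;> linarith [h1.1, h1.2, h2.1, h2.2]

lemma abs_quadForm_sub_lanQF_le_bestPolyError (hA : A.IsHermitian) (hb : ‖b‖ = 1) {k : ℕ}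
    (hk : 0 < k) {f : ℝ → ℝ} (hf : BddAbove ((fun x => |f x|) '' spectralInterval A)) :
    |quadForm (cfc f A) b - lanQF A b k f| ≤
      2 * bestPolyError (spectralInterval A) (2 * k) f := by
  have : Nonempty {p : ℝ[X] // p.degree < ((2 * k : ℕ) : WithBot ℕ)} :=
    ⟨⟨0, by rw [degree_zero]; exact WithBot.bot_lt_coe _⟩⟩
  rw [← div_le_iff₀' two_pos]
  refine le_ciInf fun p => ?_
  rw [div_le_iff₀' two_pos]
  refine abs_quadForm_sub_lanQF_le hA hb hk p.2 fun x hx => ?_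
  -- Boundedness of f - p must be checked, since `sSup` of an unbounded set is 0. Working with each
  -- p and then passing to the infimum avoids the existence of a best approximation.
  refine abs_le_supNormOn (f := fun x => f x - p.1.eval x) ?_ hx
  obtain ⟨C, hC⟩ := (isCompact_Icc (a := sInf (spectrum ℝ A))
    (b := sSup (spectrum ℝ A))).exists_bound_of_continuousOn p.1.continuous.continuousOn
  refine ⟨supNormOn (spectralInterval A) f + C, ?_⟩
  rintro _ ⟨y, hy, rfl⟩
  exact (abs_sub _ _).trans (add_le_add (abs_le_supNormOn hf hy) (hC y hy))

end LanczosQuadrature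

lemma abs_sub_slq_le {d m : ℕ} (k : ℕ) (f : ℝ → ℝ) (A : Matrix (Fin d) (Fin d) ℝ)
    (b : Fin m → EuclideanSpace ℝ (Fin d)) (a : ℝ) :
    |a - slq k f A b| ≤ |a - (m : ℝ)⁻¹ * ∑ l, quadForm (cfc f A) (b l)| +
      (m : ℝ)⁻¹ * ∑ l, |quadForm (cfc f A) (b l) - lanQF A (b l) k f| := by
  have h : a - slq k f A b = (a - (m : ℝ)⁻¹ * ∑ l, quadForm (cfc f A) (b l)) +
      (m : ℝ)⁻¹ * ∑ l, (quadForm (cfc f A) (b l) - lanQF A (b l) k f) := by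
    rw [slq, Finset.sum_sub_distrib]
    ring
  rw [h]
  refine (abs_add_le _ _).trans (add_le_add le_rfl ?_)
  rw [abs_mul, abs_of_nonneg (by positivity : (0 : ℝ) ≤ (m : ℝ)⁻¹)]
  exact mul_le_mul_of_nonneg_left (Finset.abs_sum_le_sum_abs _ _) (by positivity)

theorem theorem7p8 :
    ∃ C : ℝ, 0 < C ∧
      ∀ (d k m : ℕ), 0 < d → 0 < k → 0 < m →
      ∀ (A : Matrix (Fin d) (Fin d) ℝ), A.IsSymm →
      ∀ (f : ℝ → ℝ), BddAbove ((fun x => |f x|) '' spectralInterval A) →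
      ∀ (δ : ℝ), 0 < δ → δ < 1 →
      ∀ (Ω : Type*) (_ : MeasurableSpace Ω) (P : Measure Ω) (_ : IsProbabilityMeasure P)
        (b : Fin m → Ω → EuclideanSpace ℝ (Fin d)),
        (∀ l, Measurable (b l)) → iIndepFun b P → (∀ l, P.map (b l) = sphereUniform d) →
        P {ω | |(d : ℝ)⁻¹ * (cfc f A).trace - slq k f A (fun l => b l ω)| >
              supNormOn (spectralInterval A) f * √(Real.log (2 / δ) / (C * d * m))
                + 2 * bestPolyError (spectralInterval A) (2 * k) f} ≤ ENNReal.ofReal δ ∧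
        ∀ ω, |(d : ℝ)⁻¹ * (cfc f A).trace - slq k f A (fun l => b l ω)| ≤
          |(d : ℝ)⁻¹ * (cfc f A).trace - (m : ℝ)⁻¹ * ∑ l, quadForm (cfc f A) (b l ω)| +
            (m : ℝ)⁻¹ * ∑ l, |quadForm (cfc f A) (b l ω) - lanQF A (b l ω) k f| := by
  refine ⟨1 / 4, by norm_num, fun d k m hd hk hm A hA f hf δ hδ hδ1 Ω _ P _ b hb hind hlaw =>
    ⟨?_, fun ω => abs_sub_slq_le k f A (fun l => b l ω) _⟩⟩
  have hA' := isHermitian_of_isSymm hA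
  have hm' : (0 : ℝ) < m := by positivity
  have hnorm : ∀ᵐ ω ∂P, ∀ l, ‖b l ω‖ = 1 := by
    rw [ae_all_iff]
    intro l
    have h := ae_norm_eq_one_sphereUniform d
    rw [← hlaw l] at h
    exact ae_of_ae_map (hb l).aemeasurable h
  -- Almost surely all b_l are unit vectors, so the quadrature error is at most the second threshold
  -- term and the noise must exceed the first. Only monotonicity of `P` is used, so the event need
  -- not be measurable.
  refine le_trans (measure_mono_ae ?_) (measure_traceEstimator_deviation_le hd hm hA'
    (fun i => abs_le_supNormOn hf (eigenvalues_mem_spectralInterval hA' i)) hδ hδ1 hb hind hlaw)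
  filter_upwards [hnorm] with ω hω hlt
  have h1 := abs_sub_slq_le k f A (fun l => b l ω) ((d : ℝ)⁻¹ * (cfc f A).trace)
  have h2 : (m : ℝ)⁻¹ * ∑ l, |quadForm (cfc f A) (b l ω) - lanQF A (b l ω) k f| ≤
      2 * bestPolyError (spectralInterval A) (2 * k) f := by
    rw [inv_mul_le_iff₀ hm']
    refine (Finset.sum_le_card_nsmul _ _ _ fun l _ =>
      abs_quadForm_sub_lanQF_le_bestPolyError hA' (hω l) hk hf).trans_eq ?_
    simp
  have h3 : _ > _ := hlt
  change _ < _
  linarith
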